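/- An ultragraph $\mathcal G=(G^0,\mathcal G^1,r,s)$ consists of countable sets $G^0$ (vertices) and $\mathcal G^1$ (edges), a source map $s:\mathcal G^1\to G^0$ and a range map $r:\mathcal G^1\to \mathcal P(G^0)\setminus\{\emptyset\}$. Let $\mathcal G^0$ be the smallest collection of subsets of $G^0$ that contains $\emptyset$, all $\{v\}$ $(v\in G^0)$ and all $r(e)$ $(e\in\mathcal G^1)$ and is closed under finite unions and under intersections of finitely many (at least one) members. A sink is a vertex $v$ with $s^{-1}(v)=\emptyset$. A cycle is a sequence of edges $e_1\cdots e_n$, $n\ge 1$, with $s(e_{i+1})\in r(e_i)$ for $1\le i<n$ and $s(e_1)\in r(e_n)$; put $e_{n+1}:=e_1$. An exit for this cycle is an edge $e$ such that, for some $i\in\{1,\dots,n\}$, $s(e)\in r(e_i)$ and $e\ne e_{i+1}$. The ultragraph satisfies Condition (L) if for every cycle $e_1\cdots e_n$, either the cycle has an exit or some $r(e_i)$ contains a sink. For a commutative ring $R$ with unit, the Leavitt path algebra $L_R(\mathcal G)$ is the universal associative (not necessarily unital) $R$-algebra with generators $\{s_e,s_e^*:e\in\mathcal G^1\}\cup\{p_A:A\in\mathcal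 G^0\}$ and relations 1. $p_\emptyset=0$, $p_Ap_B=p_{A\cap B}$, $p_{A\cup B}=p_A+p_B-p_{A\cap B}$ for all $A,B\in\mathcal G^0$; 2. $p_{\{s(e)\}}s_e=s_ep_{r(e)}=s_e$ and $p_{r(e)}s_e^*=s_e^*p_{\{s(e)\}}=s_e^*$ for all $e\in\mathcal G^1$; 3. $s_e^*s_e=p_{r(e)}$ for all $e\in\mathcal G^1$, and $s_e^*s_f=0$ for all $e\neq f$ in $\mathcal G^1$; 4. $p_{\{v\}}=\sum_{s(e)=v}s_es_e^*$ for every $v\in G^0$ with $0<|s^{-1}(v)|<\infty$. **Cuntz–Krieger uniqueness theorem.** Let $\mathcal G$ be an ultragraph that satisfies Condition (L), let $R$ be a commutative ring with unit, let $S$ be a (not necessarily unital) ring and let $\pi:L_R(\mathcal G)\to S$ be a ring homomorphism such that $\pi(r\,p_A)\neq 0$ for every non-empty $A\in\mathcal G^0$ and every non-zero $r\in R$. Then $\pi$ is injective. -/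

import Mathlib

/-- An ultragraph with vertex set `V` and edge set `E`, both countable: every edge has a source
vertex, and its range is a non-empty set of vertices. -/
structure Ultragraph (V : Type*) (E : Type*) where
  source : E → V
  range : E → Set V
  range_nonempty : ∀ e, (range e).Nonempty
  countable_vertices : Countable V
  countable_edges : Countable E

namespace Ultragraph

universe u v w

section Graph

variable {V : Type u} {E : Type v} (G : Ultragraph V E)

/-- Membership in the smallest collection of sets of vertices that contains all singletons and all
ranges of edges and is closed under finite unions (with the empty union `∅`) and under finite
intersections of non-empty families. -/
inductive IsGenVertex : Set V → Prop
  | empty : IsGenVertex ∅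
  | singleton (v : V) : IsGenVertex {v}
  | range (e : E) : IsGenVertex (G.range e)
  | union {A B : Set V} : IsGenVertex A → IsGenVertex B → IsGenVertex (A ∪ B)
  | inter {A B : Set V} : IsGenVertex A → IsGenVertex B → IsGenVertex (A ∩ B)

/-- The collection of generalized vertices. -/
abbrev GenVertex : Type u := {A : Set V // G.IsGenVertex A}

/-- A sink is a vertex that emits no edge. -/
def IsSink (v : V) : Prop := ∀ e : E, G.source e ≠ v

/-- A cycle `α 0, …, α n` (of length `n + 1 ≥ 1`). The index `i + 1` is taken in `Fin (n + 1)`, so it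
is cyclic: for `i < n` the condition says that `α` is a path, and for `i = n` it says that the source
of `α` lies in the range of `α`. -/
def IsCycle {n : ℕ} (α : Fin (n + 1) → E) : Prop :=
  ∀ i, G.source (α (i + 1)) ∈ G.range (α i)

/-- An edge `e` is an exit of the cycle `α` if it starts in the range of some edge of `α` and is
not the next edge of `α` (indices cyclic). In particular, every edge `e ≠ α j` with the same source
as `α j` is an exit. -/
def IsExit {n : ℕ} (α : Fin (n + 1) → E) (e : E) : Prop :=
  ∃ i, G.source e ∈ G.range (α i) ∧ e ≠ α (i + 1)

/-- Condition (L): every cycle has an exit, or has an edge whose range contains a sink. -/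
def ConditionL : Prop :=
  ∀ (n : ℕ) (α : Fin (n + 1) → E), G.IsCycle α →
    (∃ e, G.IsExit α e) ∨ ∃ i, ∃ v ∈ G.range (α i), G.IsSink v

/-- The generators `p_A`, `s_e` and `s_e^*` of the Leavitt path algebra. -/
inductive Generator : Type (max u v)
  | proj (A : G.GenVertex) : Generator
  | edge (e : E) : Generator
  | ghost (e : E) : Generator

end Graph

noncomputable section Algebra

variable (R : Type w) [CommRing R] {V : Type u} {E : Type v} (G : Ultragraph V E)

/-- The free associative, not necessarily unital `R`-algebra on the generators: the semigroup algebra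
of the free semigroup. -/
abbrev FreeAlg : Type (max u v w) := MonoidAlgebra R (FreeSemigroup G.Generator)

/-- The generator `x` in the free algebra. -/
def gen (x : G.Generator) : G.FreeAlg R := MonoidAlgebra.single (FreeSemigroup.of x) 1

/-- The free generator `p_A`. -/
abbrev fp (A : Set V) (hA : G.IsGenVertex A) : G.FreeAlg R := G.gen R (.proj ⟨A, hA⟩)

/-- The free generator `s_e`. -/
abbrev fs (e : E) : G.FreeAlg R := G.gen R (.edge e)

/-- The free generator `s_e^*`. -/
abbrev ft (e : E) : G.FreeAlg R := G.gen R (.ghost e)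

/-- The defining relations of the Leavitt path algebra. -/
inductive Rel : G.FreeAlg R → G.FreeAlg R → Prop
  | p_empty : Rel (G.fp R ∅ .empty) 0
  | p_mul {A B : Set V} (hA : G.IsGenVertex A) (hB : G.IsGenVertex B) :
      Rel (G.fp R A hA * G.fp R B hB) (G.fp R (A ∩ B) (.inter hA hB))
  | p_union {A B : Set V} (hA : G.IsGenVertex A) (hB : G.IsGenVertex B) :
      Rel (G.fp R (A ∪ B) (.union hA hB))
        (G.fp R A hA + G.fp R B hB - G.fp R (A ∩ B) (.inter hA hB))
  | source_mul_s (e : E) : Rel (G.fp R {G.source e} (.singleton _) * G.fs R e) (G.fs R e)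
  | s_mul_range (e : E) : Rel (G.fs R e * G.fp R (G.range e) (.range e)) (G.fs R e)
  | range_mul_t (e : E) : Rel (G.fp R (G.range e) (.range e) * G.ft R e) (G.ft R e)
  | t_mul_source (e : E) : Rel (G.ft R e * G.fp R {G.source e} (.singleton _)) (G.ft R e)
  | t_mul_s_same (e : E) : Rel (G.ft R e * G.fs R e) (G.fp R (G.range e) (.range e))
  | t_mul_s_of_ne {e f : E} (h : e ≠ f) : Rel (G.ft R e * G.fs R f) 0
  | p_vertex (v : V) (hfin : {e : E | G.source e = v}.Finite)
      (hne : {e : E | G.source e = v}.Nonempty) :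
      Rel (G.fp R {v} (.singleton v)) (∑ e ∈ hfin.toFinset, G.fs R e * G.ft R e)

/-- The ring congruence generated by all scalar multiples of the defining relations, which is the
smallest congruence of `R`-algebras that contains the defining relations. -/
def leavittCon : RingCon (G.FreeAlg R) :=
  ringConGen fun x y => ∃ (c : R) (a b : G.FreeAlg R), G.Rel R a b ∧ x = c • a ∧ y = c • b

theorem leavittCon_smul (c : R) {x y : G.FreeAlg R} (h : G.leavittCon R x y) :
    G.leavittCon R (c • x) (c • y) := by
  change RingConGen.Rel _ x y at h
  change RingConGen.Rel _ (c • x) (c • y)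
  induction h with
  | of x y h =>
    obtain ⟨d, a, b, hab, rfl, rfl⟩ := h
    exact .of _ _ ⟨c * d, a, b, hab, by rw [mul_smul], by rw [mul_smul]⟩
  | refl x => exact .refl _
  | symm _ ih => exact .symm ih
  | trans _ _ ih₁ ih₂ => exact .trans ih₁ ih₂
  | add _ _ ih₁ ih₂ => rw [smul_add, smul_add]; exact .add ih₁ ih₂
  | mul _ h₂ ih₁ _ => rw [← smul_mul_assoc, ← smul_mul_assoc]; exact .mul ih₁ h₂

/-- The Leavitt path algebra `L_R(G)`: the universal (associative, not necessarily unital)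
`R`-algebra with the above generators and relations. -/
def LeavittPathAlgebra : Type (max u v w) := (G.leavittCon R).Quotient

namespace LeavittPathAlgebra

instance : NonUnitalRing (G.LeavittPathAlgebra R) :=
  inferInstanceAs (NonUnitalRing (G.leavittCon R).Quotient)

/-- The quotient map from the free algebra. -/
def mk (x : G.FreeAlg R) : G.LeavittPathAlgebra R := RingCon.toQuotient x

variable {R G} in
theorem mk_surjective : Function.Surjective (mk R G) := Quotient.mk''_surjective

instance : SMul R (G.LeavittPathAlgebra R) where
  smul c := Quotient.map' (fun x : G.FreeAlg R => c • x) fun _ _ h => G.leavittCon_smul R c h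

theorem mk_smul (c : R) (x : G.FreeAlg R) : mk R G (c • x) = c • mk R G x := rfl
theorem mk_add (x y : G.FreeAlg R) : mk R G (x + y) = mk R G x + mk R G y := rfl
theorem mk_mul (x y : G.FreeAlg R) : mk R G (x * y) = mk R G x * mk R G y := rfl
theorem mk_zero : mk R G 0 = 0 := rfl

instance : Module R (G.LeavittPathAlgebra R) where
  one_smul x := by
    obtain ⟨x, rfl⟩ := mk_surjective x
    rw [← mk_smul, one_smul]
  mul_smul c d x := by
    obtain ⟨x, rfl⟩ := mk_surjective x
    rw [← mk_smul, ← mk_smul, ← mk_smul, mul_smul]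
  smul_zero c := by rw [← mk_zero, ← mk_smul, smul_zero]
  smul_add c x y := by
    obtain ⟨x, rfl⟩ := mk_surjective x
    obtain ⟨y, rfl⟩ := mk_surjective y
    rw [← mk_add, ← mk_smul, ← mk_smul, ← mk_smul, ← mk_add, smul_add]
  add_smul c d x := by
    obtain ⟨x, rfl⟩ := mk_surjective x
    rw [← mk_smul, ← mk_smul, ← mk_smul, ← mk_add, add_smul]
  zero_smul x := by
    obtain ⟨x, rfl⟩ := mk_surjective x
    rw [← mk_smul, zero_smul, mk_zero]

instance : IsScalarTower R (G.LeavittPathAlgebra R) (G.LeavittPathAlgebra R) where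
  smul_assoc c x y := by
    obtain ⟨x, rfl⟩ := mk_surjective x
    obtain ⟨y, rfl⟩ := mk_surjective y
    simp only [smul_eq_mul, ← mk_smul, ← mk_mul, smul_mul_assoc]

instance : SMulCommClass R (G.LeavittPathAlgebra R) (G.LeavittPathAlgebra R) where
  smul_comm c x y := by
    obtain ⟨x, rfl⟩ := mk_surjective x
    obtain ⟨y, rfl⟩ := mk_surjective y
    simp only [smul_eq_mul, ← mk_smul, ← mk_mul, mul_smul_comm]

/-- The element `p_A` of the Leavitt path algebra. -/
def p (A : G.GenVertex) : G.LeavittPathAlgebra R := mk R G (G.gen R (.proj A))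

/-- The element `s_e` of the Leavitt path algebra. -/
def s (e : E) : G.LeavittPathAlgebra R := mk R G (G.gen R (.edge e))

/-- The element `s_e^*` of the Leavitt path algebra. -/
def sStar (e : E) : G.LeavittPathAlgebra R := mk R G (G.gen R (.ghost e))

end LeavittPathAlgebra

end Algebra

end Ultragraph

/-! The kernel of `π` is viewed as an ideal `I` of the unitization of the algebra, where the empty
path acts as `1`. The hypothesis is used only for vertices: `I` contains no non-zero multiple of a
`p_v` (`Faithful`). The claim is that an element of the algebra lying in `I` is zero.

Condition (L) enters once, in `Faithful.eq_empty_of_sum_mem`. Given a combination of paths ending at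
`v` that lies in `I`, multiply by `s_α^*` for a shortest path `α`: what remains is a multiple of
`p_v` plus closed paths at `v`. A path `μ` that winds around a cycle and leaves it through an exit,
or that stops at a sink, kills all these closed paths after compression by `s_μ^*` and `s_μ`
(`exists_compression`). Hence a multiple of some `p_w` lies in `I`, and its coefficient is zero.

For sums of terms `s_α a` with `a` diagonal, this shows that `x p_v ∈ I` forces `x p_v = 0`.
Elements that involve ghost edges are handled by induction on the number of ghost edges
(`Faithful.eq_zero_of_mem`). If `x ∈ I`, each `x s_f` lies one level lower and vanishes, so `x = y
(1 - ∑ s_e s_e^*)` with `y` free of ghosts and a finite sum. Such an element is checked to vanish at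
each vertex (`Faithful.mul_one_sub_eq_zero`). No grading and no basis of the algebra is needed. -/

namespace Ultragraph

universe u v w x

/-! ### Calculus of path monomials in a unital ring -/

section Family

variable {V : Type u} {E : Type v} {G : Ultragraph V E}

/-- The generalized vertex `{v}`. -/
def vert (G : Ultragraph V E) (v : V) : G.GenVertex := ⟨{v}, .singleton v⟩

/-- The generalized vertex `r(e)`. -/
def rng (G : Ultragraph V E) (e : E) : G.GenVertex := ⟨G.range e, .range e⟩

/-- A family of elements of a unital ring that satisfies the relations of the Leavitt path
algebra. -/
structure Family (G : Ultragraph V E) (U : Type x) [Ring U] where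
  p : G.GenVertex → U
  s : E → U
  t : E → U
  p_empty : p ⟨∅, .empty⟩ = 0
  p_mul (A B : G.GenVertex) : p A * p B = p ⟨A.1 ∩ B.1, .inter A.2 B.2⟩
  p_union (A B : G.GenVertex) :
    p ⟨A.1 ∪ B.1, .union A.2 B.2⟩ = p A + p B - p ⟨A.1 ∩ B.1, .inter A.2 B.2⟩
  source_mul_s (e : E) : p (G.vert (G.source e)) * s e = s e
  s_mul_range (e : E) : s e * p (G.rng e) = s e
  range_mul_t (e : E) : p (G.rng e) * t e = t e
  t_mul_source (e : E) : t e * p (G.vert (G.source e)) = t e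
  t_mul_s_same (e : E) : t e * s e = p (G.rng e)
  t_mul_s_of_ne {e f : E} (h : e ≠ f) : t e * s f = 0
  p_vertex (v : V) (hfin : {e : E | G.source e = v}.Finite)
    (hne : {e : E | G.source e = v}.Nonempty) :
    p (G.vert v) = ∑ e ∈ hfin.toFinset, s e * t e

namespace Family

variable {U : Type x} [Ring U] (F : Family G U)

theorem p_comm (A B : G.GenVertex) : F.p A * F.p B = F.p B * F.p A := by
  rw [F.p_mul, F.p_mul]
  congr 2
  exact Set.inter_comm _ _

theorem p_mul_of_subset {A B : G.GenVertex} (h : A.1 ⊆ B.1) : F.p A * F.p B = F.p A := by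
  rw [F.p_mul]
  congr 1
  exact Subtype.ext (Set.inter_eq_left.2 h)

theorem p_mul_of_inter_eq_empty {A B : G.GenVertex} (h : A.1 ∩ B.1 = ∅) :
    F.p A * F.p B = 0 := by
  rw [F.p_mul, ← F.p_empty]
  congr 1
  exact Subtype.ext h

theorem p_mul_self (A : G.GenVertex) : F.p A * F.p A = F.p A := F.p_mul_of_subset subset_rfl

theorem p_mul_vert_of_mem {A : G.GenVertex} {v : V} (h : v ∈ A.1) :
    F.p A * F.p (G.vert v) = F.p (G.vert v) := by
  rw [p_comm]
  exact F.p_mul_of_subset (Set.singleton_subset_iff.2 h)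

theorem p_mul_vert_of_notMem {A : G.GenVertex} {v : V} (h : v ∉ A.1) :
    F.p A * F.p (G.vert v) = 0 :=
  F.p_mul_of_inter_eq_empty (Set.inter_singleton_eq_empty.2 h)

theorem p_mul_s_of_mem {A : G.GenVertex} {e : E} (h : G.source e ∈ A.1) :
    F.p A * F.s e = F.s e := by
  rw [← F.source_mul_s, ← mul_assoc, F.p_mul_vert_of_mem h]

theorem p_mul_s_of_notMem {A : G.GenVertex} {e : E} (h : G.source e ∉ A.1) :
    F.p A * F.s e = 0 := by
  rw [← F.source_mul_s, ← mul_assoc, F.p_mul_vert_of_notMem h, zero_mul]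

theorem t_mul_p_of_mem {A : G.GenVertex} {e : E} (h : G.source e ∈ A.1) :
    F.t e * F.p A = F.t e := by
  rw [← F.t_mul_source, mul_assoc, F.p_comm, F.p_mul_vert_of_mem h]

theorem t_mul_p_of_notMem {A : G.GenVertex} {e : E} (h : G.source e ∉ A.1) :
    F.t e * F.p A = 0 := by
  rw [← F.t_mul_source, mul_assoc, F.p_comm, F.p_mul_vert_of_notMem h, mul_zero]

/-- The product `s_α` of the edges of a list. -/
def sl (α : List E) : U := (α.map F.s).prod

/-- The product `s_α^*`. -/
def tl (α : List E) : U := (α.map F.t).reverse.prod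

@[simp] theorem sl_nil : F.sl [] = 1 := rfl
@[simp] theorem tl_nil : F.tl [] = 1 := rfl
@[simp] theorem sl_cons (e : E) (α : List E) : F.sl (e :: α) = F.s e * F.sl α := by simp [sl]
@[simp] theorem tl_cons (e : E) (α : List E) : F.tl (e :: α) = F.tl α * F.t e := by simp [tl]
@[simp] theorem sl_append (α β : List E) : F.sl (α ++ β) = F.sl α * F.sl β := by simp [sl]
@[simp] theorem tl_append (α β : List E) : F.tl (α ++ β) = F.tl β * F.tl α := by simp [tl]

/-- After the common prefix is cancelled, the first letters that differ meet as `s_e^* s_f = 0`.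
Each cancellation leaves a projection `p_{r(e)}`, which the next edge either absorbs or turns into
zero. -/
theorem tl_mul_sl_eq_zero : ∀ {α β : List E}, ¬ α <+: β → ¬ β <+: α → F.tl α * F.sl β = 0
  | [], _, h, _ => (h List.nil_prefix).elim
  | _, [], _, h => (h List.nil_prefix).elim
  | e :: α, f :: β, h, h' => by
    rw [tl_cons, sl_cons, mul_assoc, ← mul_assoc (F.t e)]
    by_cases hef : e = f
    · subst hef
      rw [List.prefix_cons_inj] at h h'
      have ih := tl_mul_sl_eq_zero h h'
      rw [F.t_mul_s_same]
      cases β with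
      | nil => exact (h' List.nil_prefix).elim
      | cons g β =>
        by_cases hg : G.source g ∈ (G.rng e).1
        · rw [sl_cons, ← mul_assoc (F.p _), F.p_mul_s_of_mem hg, ← sl_cons, ih]
        · rw [sl_cons, ← mul_assoc (F.p _), F.p_mul_s_of_notMem hg, zero_mul, mul_zero]
    · rw [F.t_mul_s_of_ne hef, zero_mul, mul_zero]

/-- The list need not be a path, so the product may vanish; this is covered by `A = ∅`. The value
`1` comes from the empty list and need not be one of the `p_A`. -/
theorem tl_mul_sl (α : List E) :
    F.sl α * (F.tl α * F.sl α) = F.sl α ∧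
      (F.tl α * F.sl α = 1 ∨ ∃ A, F.tl α * F.sl α = F.p A) := by
  induction α using List.reverseRecOn with
  | nil => simp
  | append_singleton α e ih =>
    obtain ⟨h₁, h₂⟩ := ih
    have key : (F.tl α * F.sl α) * F.s e = F.s e ∨ (F.tl α * F.sl α) * F.s e = 0 := by
      rcases h₂ with h₂ | ⟨A, h₂⟩
      · simp [h₂]
      · rw [h₂]
        by_cases h : G.source e ∈ A.1
        · exact .inl (F.p_mul_s_of_mem h)
        · exact .inr (F.p_mul_s_of_notMem h)
    have hts : F.tl (α ++ [e]) * F.sl (α ++ [e]) = F.t e * ((F.tl α * F.sl α) * F.s e) := by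
      simp [mul_assoc]
    have hs : F.sl (α ++ [e]) = F.sl α * F.s e := by simp
    rw [hts]
    rcases key with key | key
    · rw [key, F.t_mul_s_same]
      exact ⟨by rw [hs, mul_assoc, F.s_mul_range], .inr ⟨_, rfl⟩⟩
    · rw [key, mul_zero]
      refine ⟨?_, .inr ⟨_, F.p_empty.symm⟩⟩
      rw [hs, mul_zero, ← h₁, mul_assoc, key, mul_zero]

end Family

/-- The source of the path `α` that ends in `w`. -/
def src (G : Ultragraph V E) (w : V) : List E → V
  | [] => w
  | e :: _ => G.source e

/-- The list `α` is a path whose range contains `w`. -/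
def PathTo (G : Ultragraph V E) (w : V) : List E → Prop
  | [] => True
  | e :: α => G.src w α ∈ G.range e ∧ G.PathTo w α

theorem src_append (w : V) (α β : List E) : G.src w (α ++ β) = G.src (G.src w β) α := by
  cases α <;> rfl

theorem pathTo_append (w : V) (α β : List E) :
    G.PathTo w (α ++ β) ↔ G.PathTo (G.src w β) α ∧ G.PathTo w β := by
  induction α with
  | nil => simp [PathTo]
  | cons e α ih => simp [PathTo, ih, src_append, and_assoc]

namespace Family

variable {U : Type x} [Ring U] (F : Family G U)

theorem p_mul_sl_of_mem {A : G.GenVertex} {w : V} {α : List E} (h : G.src w α ∈ A.1) :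
    F.p A * (F.sl α * F.p (G.vert w)) = F.sl α * F.p (G.vert w) := by
  cases α with
  | nil => rw [sl_nil, one_mul]; exact F.p_mul_vert_of_mem (v := w) h
  | cons e α => rw [sl_cons, mul_assoc (F.s e), ← mul_assoc, F.p_mul_s_of_mem h]

theorem p_mul_sl_of_notMem {A : G.GenVertex} {w : V} {α : List E} (h : G.src w α ∉ A.1) :
    F.p A * (F.sl α * F.p (G.vert w)) = 0 := by
  cases α with
  | nil => rw [sl_nil, one_mul]; exact F.p_mul_vert_of_notMem (v := w) h
  | cons e α => rw [sl_cons, mul_assoc (F.s e), ← mul_assoc, F.p_mul_s_of_notMem h, zero_mul]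

theorem sl_mul_vert_of_not_pathTo {w : V} {α : List E} (h : ¬ G.PathTo w α) :
    F.sl α * F.p (G.vert w) = 0 := by
  induction α with
  | nil => exact (h trivial).elim
  | cons e α ih =>
    rw [sl_cons, mul_assoc]
    by_cases h' : G.PathTo w α
    · rw [← F.s_mul_range, mul_assoc, F.p_mul_sl_of_notMem (fun h'' => h ⟨h'', h'⟩), mul_zero]
    · rw [ih h', mul_zero]

theorem tl_mul_sl_mul_vert {w : V} {α : List E} (h : G.PathTo w α) :
    F.tl α * (F.sl α * F.p (G.vert w)) = F.p (G.vert w) := by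
  induction α with
  | nil => simp
  | cons e α ih =>
    have h1 : F.tl (e :: α) * (F.sl (e :: α) * F.p (G.vert w)) =
        F.tl α * ((F.t e * F.s e) * (F.sl α * F.p (G.vert w))) := by simp [mul_assoc]
    rw [h1, F.t_mul_s_same, F.p_mul_sl_of_mem (A := G.rng e) h.1, ih h.2]

end Family

end Family

/-! ### The span of the projections is detected by vertices -/

section Diagonal

namespace Family

variable {R : Type w} [CommRing R] {V : Type u} {E : Type v} {G : Ultragraph V E}
  {U : Type x} [Ring U] [Algebra R U] (F : Family G U)

variable (R) in
/-- No non-zero multiple of a vertex projection lies in the ideal `I`. -/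
def Faithful (I : TwoSidedIdeal U) : Prop :=
  ∀ (v : V) (r : R), r • F.p (G.vert v) ∈ I → r = 0

variable (R) in
/-- The span of the projections `p_A`. -/
def diag : Submodule R U := Submodule.span R (Set.range F.p)

theorem p_mem_diag (A : G.GenVertex) : F.p A ∈ F.diag R := Submodule.subset_span ⟨A, rfl⟩

theorem diag_mul_mem {a : U} (ha : a ∈ F.diag R) (B : G.GenVertex) : a * F.p B ∈ F.diag R := by
  induction ha using Submodule.span_induction with
  | mem x hx =>
    obtain ⟨A, rfl⟩ := hx
    rw [F.p_mul]
    exact F.p_mem_diag _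
  | zero => simp
  | add x y _ _ hx hy => rw [add_mul]; exact add_mem hx hy
  | smul c x _ hx => rw [smul_mul_assoc]; exact Submodule.smul_mem _ _ hx

theorem p_mul_diag_mem {a : U} (ha : a ∈ F.diag R) (B : G.GenVertex) : F.p B * a ∈ F.diag R := by
  induction ha using Submodule.span_induction with
  | mem x hx =>
    obtain ⟨A, rfl⟩ := hx
    rw [F.p_mul]
    exact F.p_mem_diag _
  | zero => simp
  | add x y _ _ hx hy => rw [mul_add]; exact add_mem hx hy
  | smul c x _ hx => rw [mul_smul_comm]; exact Submodule.smul_mem _ _ hx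

theorem exists_diag_mul_vert {a : U} (ha : a ∈ F.diag R) (v : V) :
    ∃ c : R, a * F.p (G.vert v) = c • F.p (G.vert v) := by
  induction ha using Submodule.span_induction with
  | mem x hx =>
    obtain ⟨A, rfl⟩ := hx
    by_cases h : v ∈ A.1
    · exact ⟨1, by rw [F.p_mul_vert_of_mem h, one_smul]⟩
    · exact ⟨0, by rw [F.p_mul_vert_of_notMem h, zero_smul]⟩
  | zero => exact ⟨0, by simp⟩
  | add x y _ _ hx hy =>
    obtain ⟨c, hc⟩ := hx
    obtain ⟨d, hd⟩ := hy
    exact ⟨c + d, by rw [add_mul, hc, hd, add_smul]⟩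
  | smul d x _ hx =>
    obtain ⟨c, hc⟩ := hx
    exact ⟨d * c, by rw [smul_mul_assoc, hc, mul_smul]⟩

theorem exists_diag_mul_p_eq {a : U} (ha : a ∈ F.diag R) : ∃ B, a * F.p B = a := by
  induction ha using Submodule.span_induction with
  | mem x hx =>
    obtain ⟨A, rfl⟩ := hx
    exact ⟨A, F.p_mul_self A⟩
  | zero => exact ⟨⟨∅, .empty⟩, by simp⟩
  | add x y _ _ hx hy =>
    obtain ⟨A, hA⟩ := hx
    obtain ⟨B, hB⟩ := hy
    refine ⟨⟨A.1 ∪ B.1, .union A.2 B.2⟩, ?_⟩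
    rw [add_mul]
    nth_rewrite 1 [← hA]
    nth_rewrite 1 [← hB]
    rw [mul_assoc, mul_assoc, F.p_mul_of_subset Set.subset_union_left,
      F.p_mul_of_subset Set.subset_union_right, hA, hB]
  | smul d x _ hx =>
    obtain ⟨A, hA⟩ := hx
    exact ⟨A, by rw [smul_mul_assoc, hA]⟩

variable {F}

theorem Faithful.eq_zero {I : TwoSidedIdeal U} (hI : F.Faithful R I) {v : V} {r : R}
    (h : r • F.p (G.vert v) = 0) : r = 0 :=
  hI v r (h ▸ I.zero_mem)

/-- Generalized vertices are not closed under complements, so `p_B - p_B p_C` stands in for the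
projection of `B \ C`. Each `A ∈ T` cuts `B \ C` in two: inside `A` the projection `p_A` acts as `1`
and its coefficient joins `d`, outside it acts as `0`. When `T` is used up only the scalar `d` is
left, and one vertex of `B \ C` shows `d = 0`. -/
theorem Faithful.sum_mul_sub_eq_zero {I : TwoSidedIdeal U} (hI : F.Faithful R I)
    (c : G.GenVertex → R) (T : Finset G.GenVertex) :
    ∀ (d : R) (B C : G.GenVertex),
      (∀ v ∈ B.1, v ∉ C.1 → (d • 1 + ∑ A ∈ T, c A • F.p A) * F.p (G.vert v) = 0) →
      (d • 1 + ∑ A ∈ T, c A • F.p A) * (F.p B - F.p B * F.p C) = 0 := by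
  classical
  induction T using Finset.induction_on with
  | empty =>
    intro d B C h
    by_cases hBC : B.1 ⊆ C.1
    · rw [F.p_mul_of_subset hBC, sub_self, mul_zero]
    · obtain ⟨v, hB, hC⟩ := Set.not_subset.1 hBC
      have hd : d = 0 := hI.eq_zero (v := v) (by simpa using h v hB hC)
      simp [hd]
  | insert A T hA ih =>
    intro d B C h
    rw [Finset.sum_insert hA] at h ⊢
    set X := ∑ A ∈ T, c A • F.p A
    let B' : G.GenVertex := ⟨A.1 ∩ B.1, .inter A.2 B.2⟩
    let C' : G.GenVertex := ⟨A.1 ∪ C.1, .union A.2 C.2⟩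
    have hB' : F.p B' = F.p A * F.p B := (F.p_mul A B).symm
    have hC' : F.p C' = F.p A + F.p C - F.p A * F.p C := by rw [F.p_mul]; exact F.p_union A C
    have h₁ := ih (d + c A) B' C fun v hv hv' => by
      have := h v hv.2 hv'
      rw [← this]
      simp only [add_mul, smul_mul_assoc, one_mul, F.p_mul_vert_of_mem hv.1, add_smul]
      abel
    have h₂ := ih d B C' fun v hv hv' => by
      have := h v hv (fun h' => hv' (Or.inr h'))
      rw [← this]
      simp only [add_mul, smul_mul_assoc, F.p_mul_vert_of_notMem (fun h' => hv' (Or.inl h'))]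
      simp
    have e₁ : F.p A * (F.p B' - F.p B' * F.p C) = F.p B' - F.p B' * F.p C := by
      rw [mul_sub, ← mul_assoc, hB', ← mul_assoc, F.p_mul_self]
    have e₂ : F.p A * (F.p B - F.p B * F.p C') = 0 := by
      rw [hC']
      have h1 := F.p_comm B A
      have h2 := F.p_mul_self A
      simp only [mul_sub, mul_add, ← mul_assoc, h1, h2]
      abel
    have e₃ : F.p B - F.p B * F.p C = (F.p B' - F.p B' * F.p C) + (F.p B - F.p B * F.p C') := by
      rw [hC', hB', F.p_comm A B]
      noncomm_ring
    rw [e₃, mul_add]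
    have k₁ : (d • 1 + (c A • F.p A + X)) * (F.p B' - F.p B' * F.p C) =
        ((d + c A) • 1 + X) * (F.p B' - F.p B' * F.p C) := by
      simp only [add_mul _ _ (F.p B' - F.p B' * F.p C), smul_mul_assoc, one_mul, e₁, add_smul]
      abel
    have k₂ : (d • 1 + (c A • F.p A + X)) * (F.p B - F.p B * F.p C') =
        (d • 1 + X) * (F.p B - F.p B * F.p C') := by
      simp only [add_mul _ _ (F.p B - F.p B * F.p C'), smul_mul_assoc, one_mul, e₂]
      simp
    rw [k₁, k₂, h₁, h₂, add_zero]

theorem Faithful.diag_eq_zero {I : TwoSidedIdeal U} (hI : F.Faithful R I) {a : U}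
    (ha : a ∈ F.diag R) (h : ∀ v, a * F.p (G.vert v) = 0) : a = 0 := by
  obtain ⟨B, hB⟩ := F.exists_diag_mul_p_eq ha
  obtain ⟨c, rfl⟩ := (Finsupp.mem_span_range_iff_exists_finsupp).1 ha
  have := hI.sum_mul_sub_eq_zero c c.support 0 B ⟨∅, .empty⟩ fun v _ _ => by
    simpa [Finsupp.sum] using h v
  rw [F.p_empty, mul_zero, sub_zero, zero_smul, zero_add] at this
  rw [← hB]
  exact this

/-- The element `s_α^* s_α a` is again diagonal, so vertices detect it, and multiplication by `s_α`
recovers `s_α a`. -/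
theorem Faithful.sl_mul_diag_eq_zero {I : TwoSidedIdeal U} (hI : F.Faithful R I) {a : U}
    (ha : a ∈ F.diag R) {α : List E} (h : ∀ v, F.sl α * a * F.p (G.vert v) = 0) :
    F.sl α * a = 0 := by
  obtain ⟨h₁, h₂⟩ := F.tl_mul_sl α
  have : F.tl α * F.sl α * a = 0 := by
    refine hI.diag_eq_zero (R := R) ?_ fun v => ?_
    · rcases h₂ with h₂ | ⟨A, h₂⟩
      · rwa [h₂, one_mul]
      · rw [h₂]
        exact F.p_mul_diag_mem ha A
    · rw [mul_assoc (F.tl α), mul_assoc, h, mul_zero]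
  rw [← h₁, mul_assoc, this, mul_zero]

end Family

end Diagonal

/-! ### Closed paths and periodic words -/

section Paths

variable {V : Type u} {E : Type v} {G : Ultragraph V E}

theorem PathTo.src_drop_mem {w : V} :
    ∀ {α : List E}, G.PathTo w α → ∀ (i : ℕ) (hi : i < α.length),
      G.src w (α.drop (i + 1)) ∈ G.range α[i]
  | [], _, i, hi => absurd hi (Nat.not_lt_zero i)
  | _ :: _, h, 0, _ => by simpa using h.1
  | _ :: _, h, i + 1, hi => by
    simpa using h.2.src_drop_mem i (Nat.lt_of_succ_lt_succ hi)

theorem src_drop {w : V} {α : List E} {i : ℕ} (hi : i < α.length) :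
    G.src w (α.drop i) = G.source α[i] := by
  rw [List.drop_eq_getElem_cons hi]
  rfl

theorem pathTo_map_range {z : ℕ → E} (hz : ∀ k, G.source (z (k + 1)) ∈ G.range (z k)) (n : ℕ) :
    G.PathTo (G.source (z n)) ((List.range n).map z) ∧
      G.src (G.source (z n)) ((List.range n).map z) = G.source (z 0) := by
  induction n with
  | zero => simp [PathTo, src]
  | succ n ih =>
    rw [List.range_succ, List.map_append, pathTo_append, src_append]
    exact ⟨⟨ih.1, hz n, trivial⟩, ih.2⟩

/-- A closed path is a cycle, and its infinite repetition is an infinite path. -/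
theorem source_getElem_mod_mem {v : V} {γ : List E} (hγ : G.PathTo v γ) (hv : G.src v γ = v)
    (h0 : 0 < γ.length) (k : ℕ) :
    G.source (γ[(k + 1) % γ.length]'(Nat.mod_lt _ h0)) ∈
      G.range (γ[k % γ.length]'(Nat.mod_lt _ h0)) := by
  have hk := Nat.mod_lt k h0
  have h := hγ.src_drop_mem _ hk
  have hs : G.source (γ[0]'h0) = v := by rw [← src_drop (w := v) h0]; exact hv
  rcases Nat.lt_or_ge (k % γ.length + 1) γ.length with h' | h'
  · rw [src_drop h'] at h
    have : (k + 1) % γ.length = k % γ.length + 1 := by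
      rw [Nat.add_mod_eq_ite]
      have h1 : 1 % γ.length = 1 := Nat.mod_eq_of_lt (by omega)
      rw [h1, if_neg (by omega)]
    simpa only [this] using h
  · rw [List.drop_of_length_le h'] at h
    have : (k + 1) % γ.length = 0 := by
      rw [Nat.add_mod]
      rcases Nat.lt_or_ge 1 γ.length with h1 | h1
      · rw [Nat.mod_eq_of_lt h1, show k % γ.length + 1 = γ.length by omega, Nat.mod_self]
      · rw [show γ.length = 1 by omega, Nat.mod_one]
    simp only [this, hs]
    exact h

/-- Condition (L) for a closed path, given as a list. -/
theorem ConditionL.exists_exit_or_sink (hL : G.ConditionL) {v : V} {γ : List E} (hγ : G.PathTo v γ)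
    (hv : G.src v γ = v) (h0 : 0 < γ.length) :
    ∃ i, i < γ.length ∧
      ((∃ e, G.source e ∈ G.range (γ[i % γ.length]'(Nat.mod_lt _ h0)) ∧
          e ≠ γ[(i + 1) % γ.length]'(Nat.mod_lt _ h0)) ∨
        ∃ w ∈ G.range (γ[i % γ.length]'(Nat.mod_lt _ h0)), G.IsSink w) := by
  obtain ⟨n, hn⟩ : ∃ n, γ.length = n + 1 := ⟨γ.length - 1, by omega⟩
  let α : Fin (n + 1) → E := fun i => γ[i.1]'(by omega)
  have key : ∀ i : Fin (n + 1), α i = γ[i.1 % γ.length]'(Nat.mod_lt _ h0) := fun i => by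
    have hi : i.1 < γ.length := by omega
    simp only [α, Nat.mod_eq_of_lt hi]
  have key' : ∀ i : Fin (n + 1), α (i + 1) = γ[(i.1 + 1) % γ.length]'(Nat.mod_lt _ h0) :=
    fun i => by
      simp only [α, hn, Fin.val_add, Fin.val_one', Nat.add_mod_mod]
  have hα : G.IsCycle α := fun i => by
    rw [key, key']
    exact source_getElem_mod_mem hγ hv h0 _
  rcases hL n α hα with ⟨e, i, h₁, h₂⟩ | ⟨i, w, h₁, h₂⟩
  · exact ⟨i, by omega, .inl ⟨e, key i ▸ h₁, key' i ▸ h₂⟩⟩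
  · exact ⟨i, by omega, .inr ⟨w, key i ▸ h₁, h₂⟩⟩

/-- A periodic word followed by a letter that breaks the period has no short period. -/
theorem not_prefix_append_self {z : ℕ → E} {m : ℕ} (hz : ∀ k, z (k + m) = z k) {n : ℕ} {e : E}
    (he : e ≠ z n) {γ : List E} (hγ : γ ≠ []) (hn : m + γ.length ≤ n) (hm : 0 < m) :
    ¬ (List.range n).map z ++ [e] <+: γ ++ ((List.range n).map z ++ [e]) := by
  intro h
  have hγ' : 0 < γ.length := List.length_pos_iff.2 hγ
  have hp : ∀ i, γ.length ≤ i → i ≤ n →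
      ((List.range n).map z ++ [e])[i]? = ((List.range n).map z ++ [e])[i - γ.length]? := by
    intro i h₁ h₂
    have h₃ := h.getElem (i := i) (by simpa using Nat.lt_succ_of_le h₂)
    rw [List.getElem?_eq_getElem (by simpa using Nat.lt_succ_of_le h₂), h₃,
      List.getElem_append_right h₁, List.getElem?_eq_getElem]
  have hlt : ∀ i, i < n → ((List.range n).map z ++ [e])[i]? = some (z i) := fun i hi => by
    rw [List.getElem?_append_left (by simpa using hi)]
    simp [hi]
  -- With `l` the length of `γ`, the shift by `l` is used at two positions: `e = z (n - l)` and `z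
  -- (n - m) = z (n - m - l)`. The period `m` identifies the latter two with `z n` and `z (n - l)`,
  -- so `e = z n`.
  have h₁ := hp n (by omega) le_rfl
  have h₂ := hp (n - m) (by omega) (by omega)
  rw [hlt (n - γ.length) (by omega), List.getElem?_append_right (by simp)] at h₁
  rw [hlt _ (by omega), hlt _ (by omega)] at h₂
  simp only [List.length_map, List.length_range, Nat.sub_self, List.getElem?_cons_zero,
    Option.some.injEq] at h₁ h₂
  have h₃ := hz (n - m)
  have h₄ := hz (n - m - γ.length)
  rw [show n - m + m = n by omega] at h₃
  rw [show n - m - γ.length + m = n - γ.length by omega] at h₄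
  exact he (by rw [h₁, h₃, h₂, h₄])

end Paths

/-! ### Compression of closed paths and independence modulo the ideal -/

namespace Family

variable {V : Type u} {E : Type v} {G : Ultragraph V E} {U : Type x} [Ring U] (F : Family G U)

theorem tl_mul_sl_append_eq_zero {μ γ : List E} (hγ : γ ≠ []) (h : ¬ μ <+: γ ++ μ) :
    F.tl μ * F.sl (γ ++ μ) = 0 := by
  refine F.tl_mul_sl_eq_zero h fun h' => ?_
  have h₁ := h'.length_le
  have h₂ := List.length_pos_iff.2 hγ
  rw [List.length_append] at h₁
  omega

theorem vert_mul_tl_mul_sl {w : V} {μ : List E} (hμ : G.PathTo w μ) :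
    F.p (G.vert w) * (F.tl μ * F.sl μ) = F.p (G.vert w) := by
  have h := F.tl_mul_sl_mul_vert hμ
  rcases (F.tl_mul_sl μ).2 with h' | ⟨A, h'⟩
  · rw [h', mul_one]
  · rw [← mul_assoc, h'] at h
    rw [h', F.p_comm, h]

theorem vert_mul_sl_of_isSink {w : V} (hw : G.IsSink w) {δ : List E} (hδ : δ ≠ []) :
    F.p (G.vert w) * F.sl δ = 0 := by
  cases δ with
  | nil => exact (hδ rfl).elim
  | cons e δ =>
    rw [sl_cons, ← mul_assoc, F.p_mul_s_of_notMem (A := G.vert w) (fun h => hw e h), zero_mul]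

/-- If there is a closed path at `v`, then Condition (L) provides a path from `v` that compresses
all short closed paths at `v` to zero. -/
theorem exists_compression (hL : G.ConditionL) {v : V} {γ₀ : List E} (hγ₀ : G.PathTo v γ₀)
    (hv : G.src v γ₀ = v) (h0 : γ₀ ≠ []) (N : ℕ) :
    ∃ μ w, G.PathTo w μ ∧ G.src w μ = v ∧ ∀ γ : List E, γ ≠ [] → γ.length ≤ N →
      F.p (G.vert w) * F.tl μ * F.sl (γ ++ μ) = 0 := by
  have h0' := List.length_pos_iff.2 h0
  let z : ℕ → E := fun k => γ₀[k % γ₀.length]'(Nat.mod_lt _ h0')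
  have hz : ∀ k, G.source (z (k + 1)) ∈ G.range (z k) := source_getElem_mod_mem hγ₀ hv h0'
  have hz0 : G.source (z 0) = v := by
    simp only [z, Nat.zero_mod]
    rw [← src_drop (w := v) h0']
    exact hv
  have hper : ∀ k, z (k + γ₀.length) = z k := fun k => by simp [z]
  obtain ⟨i, hi, ⟨e, he, hne⟩ | ⟨w, hw, hsink⟩⟩ := hL.exists_exit_or_sink hγ₀ hv h0'
  · obtain ⟨w, hw⟩ := G.range_nonempty e
    -- The extra `N + 1` turns leave the exit at the same phase `i` of the cycle, and make the
    -- periodic part longer than one period plus any `γ` of length at most `N`.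
    let n := i + γ₀.length * (N + 1)
    have hper' : ∀ j, z (j + γ₀.length * (N + 1)) = z j := fun j => by simp [z]
    have hpath := pathTo_map_range hz n
    refine ⟨(List.range (n + 1)).map z ++ [e], w, ?_, ?_, fun γ hγ hN => ?_⟩
    · rw [List.range_succ, List.map_append, List.append_assoc, pathTo_append]
      exact ⟨hpath.1, (hper' i).symm ▸ he, hw, trivial⟩
    · rw [List.range_succ, List.map_append, List.append_assoc, src_append]
      exact hpath.2.trans hz0
    · rw [mul_assoc, F.tl_mul_sl_append_eq_zero hγ, mul_zero]
      refine not_prefix_append_self hper ?_ hγ ?_ h0'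
      · have : z (n + 1) = z (i + 1) := by
          rw [← hper' (i + 1)]
          congr 1
          omega
        rw [this]
        exact hne
      · have : N ≤ γ₀.length * N := Nat.le_mul_of_pos_left N h0'
        simp only [n, mul_add, mul_one]
        omega
  · have hpath := pathTo_map_range hz i
    have hμ : G.PathTo w ((List.range (i + 1)).map z) := by
      rw [List.range_succ, List.map_append, pathTo_append]
      exact ⟨hpath.1, hw, trivial⟩
    refine ⟨(List.range (i + 1)).map z, w, hμ, ?_, fun γ hγ _ => ?_⟩
    · rw [List.range_succ, List.map_append, src_append]
      exact hpath.2.trans hz0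
    -- If `γ μ = μ δ`, then `δ` is as long as `γ`, hence non-empty, and it would have to start at
    -- the sink `w`.
    · by_cases h : (List.range (i + 1)).map z <+: γ ++ (List.range (i + 1)).map z
      · obtain ⟨δ, hδ⟩ := h
        have hδ' : δ ≠ [] := by
          rintro rfl
          have h₁ := congrArg List.length hδ
          have h₂ := List.length_pos_iff.2 hγ
          rw [List.length_append, List.length_append, List.length_nil] at h₁
          omega
        rw [← hδ, sl_append, mul_assoc, ← mul_assoc (F.tl _), ← mul_assoc,
          F.vert_mul_tl_mul_sl hμ, F.vert_mul_sl_of_isSink hsink hδ']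
      · rw [mul_assoc, F.tl_mul_sl_append_eq_zero hγ h, mul_zero]

/-- Compressing a path `β` by a path `α` that is not longer gives zero or a closed path. -/
theorem vert_mul_tl_mul_sl_mul_vert {v : V} {α β : List E} (hβ : G.PathTo v β) (hne : β ≠ α)
    (hlen : α.length ≤ β.length) :
    F.p (G.vert v) * F.tl α * (F.sl β * F.p (G.vert v)) = 0 ∨
      ∃ γ, γ ≠ [] ∧ G.PathTo v γ ∧ G.src v γ = v ∧ γ.length ≤ β.length ∧
        F.p (G.vert v) * F.tl α * (F.sl β * F.p (G.vert v)) = F.sl γ * F.p (G.vert v) := by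
  by_cases h : α <+: β
  · obtain ⟨γ, rfl⟩ := h
    obtain ⟨h₁, h₂⟩ := (pathTo_append ..).1 hβ
    have hsrc : F.p (G.vert (G.src v γ)) * (F.sl γ * F.p (G.vert v)) = F.sl γ * F.p (G.vert v) :=
      F.p_mul_sl_of_mem rfl
    have key : F.tl α * (F.sl (α ++ γ) * F.p (G.vert v)) = F.sl γ * F.p (G.vert v) := by
      rw [sl_append, mul_assoc (F.sl α), ← hsrc, ← mul_assoc (F.sl α), ← mul_assoc (F.tl α),
        F.tl_mul_sl_mul_vert h₁]
    rw [mul_assoc, key]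
    by_cases hv : G.src v γ = v
    · exact .inr ⟨γ, fun h => hne (by simp [h]), h₂, hv, by simp, F.p_mul_sl_of_mem hv⟩
    · exact .inl (F.p_mul_sl_of_notMem hv)
  · refine .inl ?_
    rw [mul_assoc, ← mul_assoc (F.tl α), F.tl_mul_sl_eq_zero h, zero_mul, mul_zero]
    exact fun h' => hne (h'.eq_of_length_le hlen)

variable {F} {R : Type w} [CommRing R] [Algebra R U]

/-- Minimality of the length of `α` ensures that `s_α^* s_β` contains no ghost edges for the other
`β`: compressed at `v`, it is zero or a closed path, and a suitable `μ` then removes all closed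
paths at once. -/
theorem Faithful.eq_empty_of_sum_mem {I : TwoSidedIdeal U} (hI : F.Faithful R I)
    (hL : G.ConditionL) {v : V} {T : Finset (List E)} {c : List E → R}
    (hT : ∀ α ∈ T, G.PathTo v α) (hc : ∀ α ∈ T, c α ≠ 0)
    (h : ∑ α ∈ T, c α • (F.sl α * F.p (G.vert v)) ∈ I) : T = ∅ := by
  classical
  by_contra hne
  obtain ⟨α, hα, hmin⟩ := T.exists_min_image List.length (Finset.nonempty_iff_ne_empty.2 hne)
  have hX := fun β (hβ : β ∈ T) (hβα : β ≠ α) =>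
    F.vert_mul_tl_mul_sl_mul_vert (hT β hβ) hβα (hmin β hβ)
  obtain ⟨μ, w, hμ, hsrc, hzero⟩ : ∃ μ w, G.PathTo w μ ∧ G.src w μ = v ∧ ∀ β ∈ T, β ≠ α →
      F.p (G.vert w) * F.tl μ * (F.p (G.vert v) * F.tl α * (F.sl β * F.p (G.vert v))) *
        (F.sl μ * F.p (G.vert w)) = 0 := by
    -- Condition (L) is needed only if some closed path survives; otherwise the empty path serves as
    -- `μ`.
    by_cases hall : ∀ β ∈ T, β ≠ α →
        F.p (G.vert v) * F.tl α * (F.sl β * F.p (G.vert v)) = 0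
    · exact ⟨[], v, trivial, rfl, fun β hβ hβα => by rw [hall β hβ hβα, mul_zero, zero_mul]⟩
    · push Not at hall
      obtain ⟨β₀, hβ₀, hβ₀α, hβ₀X⟩ := hall
      obtain ⟨γ₀, hγ₀, hp₀, hs₀, -, -⟩ := (hX β₀ hβ₀ hβ₀α).resolve_left hβ₀X
      obtain ⟨μ, w, hμ, hsrc, hμγ⟩ :=
        F.exists_compression hL hp₀ hs₀ hγ₀ (T.sup List.length)
      refine ⟨μ, w, hμ, hsrc, fun β hβ hβα => ?_⟩
      rcases hX β hβ hβα with h' | ⟨γ, hγ, -, -, hγl, h'⟩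
      · rw [h', mul_zero, zero_mul]
      · have hv : F.p (G.vert v) * (F.sl μ * F.p (G.vert w)) = F.sl μ * F.p (G.vert w) :=
          F.p_mul_sl_of_mem hsrc
        have := hμγ γ hγ (hγl.trans (Finset.le_sup (f := List.length) hβ))
        rw [h', mul_assoc, mul_assoc (F.sl γ), hv, ← mul_assoc (F.sl γ), ← sl_append,
          ← mul_assoc, this, zero_mul]
  have hv : F.p (G.vert v) * (F.sl μ * F.p (G.vert w)) = F.sl μ * F.p (G.vert w) :=
    F.p_mul_sl_of_mem hsrc
  -- This two-sided product annihilates every term except the one of `α`, which becomes `c α • p_w`.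
  have hmem := I.mul_mem_right _ (F.sl μ * F.p (G.vert w))
    (I.mul_mem_left (F.p (G.vert w) * F.tl μ) _
      (I.mul_mem_left (F.p (G.vert v) * F.tl α) _ h))
  simp only [Finset.mul_sum, Finset.sum_mul, mul_smul_comm, smul_mul_assoc] at hmem
  rw [Finset.sum_eq_single_of_mem α hα fun β hβ hβα => by rw [hzero β hβ hβα, smul_zero]] at hmem
  rw [mul_assoc (F.p (G.vert v)), F.tl_mul_sl_mul_vert (hT α hα), F.p_mul_self, mul_assoc, hv,
    mul_assoc, F.tl_mul_sl_mul_vert hμ, F.p_mul_self] at hmem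
  exact hc α hα (hI w _ hmem)

/-- Distinct paths with range containing `v` are linearly independent modulo `I`. -/
theorem Faithful.smul_sl_eq_zero_of_sum_mem {I : TwoSidedIdeal U} (hI : F.Faithful R I)
    (hL : G.ConditionL) {v : V} {T : Finset (List E)} {c : List E → R}
    (h : ∑ α ∈ T, c α • (F.sl α * F.p (G.vert v)) ∈ I) {α : List E} (hα : α ∈ T)
    (hp : G.PathTo v α) : c α = 0 := by
  classical
  by_contra hc
  have := hI.eq_empty_of_sum_mem hL (v := v) (c := c)
    (T := T.filter fun α => G.PathTo v α ∧ c α ≠ 0) (fun β hβ => (Finset.mem_filter.1 hβ).2.1)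
    (fun β hβ => (Finset.mem_filter.1 hβ).2.2) (by
      rwa [Finset.sum_filter_of_ne]
      intro β _ hβ
      by_contra h'
      rw [not_and_or, not_not] at h'
      rcases h' with h' | h'
      · exact hβ (by rw [F.sl_mul_vert_of_not_pathTo h', smul_zero])
      · exact hβ (by rw [h', zero_smul]))
  exact Finset.notMem_empty α (this ▸ Finset.mem_filter.2 ⟨hα, hp, hc⟩)

end Family

/-! ### Filtration by the number of ghost edges -/

namespace Family

section Filtration

variable {V : Type u} {E : Type v} {G : Ultragraph V E} {U : Type x} [Ring U] (F : Family G U)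

theorem diag_mul_s {R : Type w} [CommRing R] [Algebra R U] {a : U} (ha : a ∈ F.diag R) (e : E) :
    ∃ c : R, a * F.s e = c • F.s e := by
  obtain ⟨c, hc⟩ := F.exists_diag_mul_vert ha (G.source e)
  exact ⟨c, by rw [← F.source_mul_s, ← mul_assoc, hc, smul_mul_assoc]⟩

variable (R : Type w) [CommRing R] [Algebra R U]

/-- The span of the elements `s_α p_A s_β^*` with `β` of length at most `n`. -/
def filtration : ℕ → Submodule R U
  | 0 => ⨆ α : List E, (F.diag R).map (LinearMap.mulLeft R (F.sl α))
  | n + 1 => filtration 0 ⊔ ⨆ e : E, (filtration n).map (LinearMap.mulRight R (F.t e))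

variable {R F}

theorem sl_mul_mem_filtration (α : List E) {a : U} (ha : a ∈ F.diag R) :
    F.sl α * a ∈ F.filtration R 0 := by
  rw [filtration]
  exact Submodule.mem_iSup_of_mem α ⟨a, ha, rfl⟩

theorem mul_t_mem_filtration {n : ℕ} {x : U} (hx : x ∈ F.filtration R n) (e : E) :
    x * F.t e ∈ F.filtration R (n + 1) := by
  rw [filtration]
  exact Submodule.mem_sup_right (Submodule.mem_iSup_of_mem e ⟨x, hx, rfl⟩)

theorem filtration_zero_induction {C : U → Prop}
    (sl_mul : ∀ α, ∀ a ∈ F.diag R, C (F.sl α * a)) (zero : C 0)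
    (add : ∀ x y, C x → C y → C (x + y)) {x : U} (hx : x ∈ F.filtration R 0) : C x := by
  rw [filtration] at hx
  induction hx using Submodule.iSup_induction' with
  | mem α x hx =>
    obtain ⟨a, ha, rfl⟩ := hx
    exact sl_mul α a ha
  | zero => exact zero
  | add x y _ _ hx hy => exact add x y hx hy

theorem filtration_succ_induction {n : ℕ} {C : U → Prop}
    (of_zero : ∀ x ∈ F.filtration R 0, C x) (mul_t : ∀ e, ∀ x ∈ F.filtration R n, C (x * F.t e))
    (add : ∀ x y, C x → C y → C (x + y)) {x : U} (hx : x ∈ F.filtration R (n + 1)) : C x := by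
  rw [filtration] at hx
  obtain ⟨y, hy, z, hz, rfl⟩ := Submodule.mem_sup.1 hx
  refine add _ _ (of_zero y hy) ?_
  clear hx
  induction hz using Submodule.iSup_induction' with
  | mem e x hx =>
    obtain ⟨a, ha, rfl⟩ := hx
    exact mul_t e a ha
  | zero => exact of_zero 0 (zero_mem _)
  | add x y _ _ hx hy => exact add _ _ hx hy

theorem filtration_le_succ (n : ℕ) : F.filtration R n ≤ F.filtration R (n + 1) := by
  induction n with
  | zero =>
    rw [filtration.eq_2]
    exact le_sup_left
  | succ n ih =>
    intro x hx
    refine filtration_succ_induction (fun x hx => ?_) (fun e x hx => mul_t_mem_filtration (ih hx) e)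
      (fun x y => add_mem) hx
    rw [filtration.eq_2]
    exact Submodule.mem_sup_left hx

theorem filtration_mono : Monotone (F.filtration R) := monotone_nat_of_le_succ filtration_le_succ

theorem mul_p_mem_filtration {n : ℕ} {x : U} (hx : x ∈ F.filtration R n) (A : G.GenVertex) :
    x * F.p A ∈ F.filtration R n := by
  cases n with
  | zero =>
    refine filtration_zero_induction (C := fun x => x * F.p A ∈ F.filtration R 0)
      (fun α a ha => ?_) (by simp) (fun x y hx hy => by rw [add_mul]; exact add_mem hx hy) hx
    rw [mul_assoc]
    exact sl_mul_mem_filtration α (F.diag_mul_mem ha A)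
  | succ n =>
    refine filtration_succ_induction (C := fun x => x * F.p A ∈ F.filtration R (n + 1))
      (fun x hx => ?_) (fun e x hx => ?_)
      (fun x y hx hy => by rw [add_mul]; exact add_mem hx hy) hx
    · refine filtration_mono (Nat.zero_le _) ?_
      refine filtration_zero_induction (C := fun x => x * F.p A ∈ F.filtration R 0)
        (fun α a ha => ?_) (by simp) (fun x y hx hy => by rw [add_mul]; exact add_mem hx hy) hx
      rw [mul_assoc]
      exact sl_mul_mem_filtration α (F.diag_mul_mem ha A)
    · rw [mul_assoc]
      by_cases h : G.source e ∈ A.1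
      · rw [F.t_mul_p_of_mem h]
        exact mul_t_mem_filtration hx e
      · rw [F.t_mul_p_of_notMem h, mul_zero]
        exact zero_mem _

theorem mul_s_mem_filtration_zero {x : U} (hx : x ∈ F.filtration R 0) (f : E) :
    x * F.s f ∈ F.filtration R 0 := by
  refine filtration_zero_induction (C := fun x => x * F.s f ∈ F.filtration R 0)
    (fun α a ha => ?_) (by simp) (fun x y hx hy => by rw [add_mul]; exact add_mem hx hy) hx
  obtain ⟨c, hc⟩ := F.diag_mul_s ha f
  have : F.sl α * a * F.s f = c • (F.sl (α ++ [f]) * F.p (G.rng f)) := by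
    rw [mul_assoc, hc, mul_smul_comm, sl_append, mul_assoc, sl_cons, sl_nil, mul_one,
      F.s_mul_range]
  rw [this]
  exact Submodule.smul_mem _ _ (sl_mul_mem_filtration _ (F.p_mem_diag _))

/-- The edge on the right cancels the last ghost edge or kills the term; this drop in level drives
the main induction. -/
theorem mul_s_mem_filtration {n : ℕ} {x : U} (hx : x ∈ F.filtration R (n + 1)) (f : E) :
    x * F.s f ∈ F.filtration R n := by
  refine filtration_succ_induction (C := fun x => x * F.s f ∈ F.filtration R n)
    (fun x hx => filtration_mono (Nat.zero_le n) (mul_s_mem_filtration_zero hx f))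
    (fun e x hx => ?_) (fun x y hx hy => by rw [add_mul]; exact add_mem hx hy) hx
  rw [mul_assoc]
  by_cases h : e = f
  · rw [h, F.t_mul_s_same]
    exact mul_p_mem_filtration hx _
  · rw [F.t_mul_s_of_ne h, mul_zero]
    exact zero_mem _

theorem exists_eq_sum_of_mem_filtration_zero {x : U} (hx : x ∈ F.filtration R 0) :
    ∃ a : List E →₀ F.diag R, x = ∑ α ∈ a.support, F.sl α * (a α : U) := by
  classical
  refine filtration_zero_induction (C := fun x => ∃ a : List E →₀ F.diag R,
    x = a.sum fun α y => F.sl α * (y : U)) (fun α a ha => ⟨.single α ⟨a, ha⟩, ?_⟩)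
    ⟨0, by simp⟩ (fun x y ⟨a, ha⟩ ⟨b, hb⟩ => ⟨a + b, ?_⟩) hx
  · rw [Finsupp.sum_single_index (by simp)]
  · rw [Finsupp.sum_add_index' (by simp) (by simp [mul_add]), ha, hb]

theorem exists_eq_add_sum_of_mem_filtration {n : ℕ} {x : U} (hx : x ∈ F.filtration R (n + 1)) :
    ∃ y ∈ F.filtration R 0, ∃ b : E →₀ U, x = y + ∑ e ∈ b.support, b e * F.t e := by
  classical
  refine filtration_succ_induction (C := fun x => ∃ y ∈ F.filtration R 0, ∃ b : E →₀ U,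
    x = y + b.sum fun e z => z * F.t e) (fun x hx => ⟨x, hx, 0, by simp⟩)
    (fun e x hx => ⟨0, zero_mem _, .single e x, ?_⟩)
    (fun x y ⟨x', hx', b, hb⟩ ⟨y', hy', c, hc⟩ => ⟨x' + y', add_mem hx' hy', b + c, ?_⟩) hx
  · rw [Finsupp.sum_single_index (by simp), zero_add]
  · rw [Finsupp.sum_add_index' (by simp) (by simp [add_mul]), hb, hc]
    abel

end Filtration

/-! ### Vanishing of the elements of the ideal -/

section Uniqueness

variable {R : Type w} [CommRing R] {V : Type u} {E : Type v} {G : Ultragraph V E}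
  {U : Type x} [Ring U] [Algebra R U] {F : Family G U} {I : TwoSidedIdeal U}

theorem Faithful.sl_mul_mul_vert_eq_zero (hI : F.Faithful R I) (hL : G.ConditionL)
    {a : List E →₀ F.diag R} {v : V}
    (h : (∑ α ∈ a.support, F.sl α * (a α : U)) * F.p (G.vert v) ∈ I) {α : List E}
    (hα : α ∈ a.support) : F.sl α * (a α : U) * F.p (G.vert v) = 0 := by
  choose c hc using fun α => F.exists_diag_mul_vert (a α).2 v
  have key : ∀ α, F.sl α * (a α : U) * F.p (G.vert v) = c α • (F.sl α * F.p (G.vert v)) :=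
    fun α => by rw [mul_assoc, hc, mul_smul_comm]
  rw [Finset.sum_mul] at h
  simp only [key] at h ⊢
  by_cases hp : G.PathTo v α
  · rw [hI.smul_sl_eq_zero_of_sum_mem hL h hα hp, zero_smul]
  · rw [F.sl_mul_vert_of_not_pathTo hp, smul_zero]

theorem Faithful.mul_vert_eq_zero (hI : F.Faithful R I) (hL : G.ConditionL) {x : U}
    (hx : x ∈ F.filtration R 0) {v : V} (h : x * F.p (G.vert v) ∈ I) :
    x * F.p (G.vert v) = 0 := by
  obtain ⟨a, rfl⟩ := exists_eq_sum_of_mem_filtration_zero hx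
  rw [Finset.sum_mul]
  exact Finset.sum_eq_zero fun α hα => hI.sl_mul_mul_vert_eq_zero hL h hα

theorem Faithful.eq_zero_of_forall_mul_vert (hI : F.Faithful R I) (hL : G.ConditionL) {x : U}
    (hx : x ∈ F.filtration R 0) (h : ∀ v, x * F.p (G.vert v) = 0) : x = 0 := by
  obtain ⟨a, rfl⟩ := exists_eq_sum_of_mem_filtration_zero hx
  exact Finset.sum_eq_zero fun α hα => hI.sl_mul_diag_eq_zero (a α).2 fun v =>
    hI.sl_mul_mul_vert_eq_zero hL ((h v).symm ▸ I.zero_mem) hα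

/-- Distinct `α` give distinct paths `α f`, which are independent modulo `I` once cut down to a
vertex `w` of `r(f)`. The coefficients of `x s_f p_w` are those of `x p_{s(f)}`. -/
theorem Faithful.mul_source_eq_zero (hI : F.Faithful R I) (hL : G.ConditionL) {x : U}
    (hx : x ∈ F.filtration R 0) {f : E} (h : x * F.s f ∈ I) :
    x * F.p (G.vert (G.source f)) = 0 := by
  classical
  obtain ⟨a, rfl⟩ := exists_eq_sum_of_mem_filtration_zero hx
  obtain ⟨w, hw⟩ := G.range_nonempty f
  choose c hc using fun α => F.exists_diag_mul_vert (a α).2 (G.source f)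
  have key : ∀ α, F.sl α * (a α : U) * F.s f * F.p (G.vert w) =
      c α • (F.sl (α ++ [f]) * F.p (G.vert w)) := fun α => by
    rw [← F.source_mul_s f, mul_assoc (F.sl α), ← mul_assoc (a α : U), hc, sl_append, sl_cons,
      sl_nil, mul_one, smul_mul_assoc, F.source_mul_s, mul_smul_comm, smul_mul_assoc]
  have hmem := I.mul_mem_right _ (F.p (G.vert w)) h
  simp only [Finset.sum_mul, key] at hmem
  have hinj : Function.Injective fun α : List E => α ++ [f] := List.append_left_injective [f]
  -- The sum is reindexed by `β = α f`; `dropLast` recovers `α`.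
  have hmem' : ∑ β ∈ a.support.map ⟨_, hinj⟩,
      c β.dropLast • (F.sl β * F.p (G.vert w)) ∈ I := by
    rw [Finset.sum_map]
    simpa using hmem
  rw [Finset.sum_mul]
  refine Finset.sum_eq_zero fun α hα => ?_
  rw [mul_assoc, hc, mul_smul_comm]
  by_cases hp : G.PathTo (G.source f) α
  · have := hI.smul_sl_eq_zero_of_sum_mem hL hmem' (Finset.mem_map_of_mem _ hα)
      (show G.PathTo w (α ++ [f]) from (pathTo_append ..).2 ⟨hp, hw, trivial⟩)
    rw [show c α = 0 by simpa using this, zero_smul]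
  · rw [F.sl_mul_vert_of_not_pathTo hp, smul_zero]

/-- At a vertex `v` there are three cases. If an edge `f ∉ T` starts at `v`, then `x s_f ∈ I` gives
`x p_v = 0`. If `v` is a sink, then `p_v Q = 0` and `x p_v` itself lies in `I`. Otherwise `v` emits
a non-empty finite set of edges, all in `T`, and relation 4 gives `p_v Q = p_v`. -/
theorem Faithful.mul_one_sub_eq_zero (hI : F.Faithful R I) (hL : G.ConditionL) {x : U}
    (hx : x ∈ F.filtration R 0) (T : Finset E)
    (hmem : x * (1 - ∑ e ∈ T, F.s e * F.t e) ∈ I) (hT : ∀ f ∉ T, x * F.s f ∈ I) :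
    x * (1 - ∑ e ∈ T, F.s e * F.t e) = 0 := by
  classical
  set Q := ∑ e ∈ T, F.s e * F.t e with hQ
  have hcomm : ∀ v, Q * F.p (G.vert v) = F.p (G.vert v) * Q := fun v => by
    rw [hQ, Finset.sum_mul, Finset.mul_sum]
    refine Finset.sum_congr rfl fun e _ => ?_
    by_cases h : G.source e = v
    · subst h
      rw [mul_assoc, F.t_mul_source, ← mul_assoc, F.source_mul_s]
    · rw [mul_assoc, F.t_mul_p_of_notMem (A := G.vert v) h, ← mul_assoc,
        F.p_mul_s_of_notMem (A := G.vert v) h, mul_zero, zero_mul]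
  have hcomm' : ∀ v, (1 - Q) * F.p (G.vert v) = F.p (G.vert v) * (1 - Q) := fun v => by
    rw [sub_mul, mul_sub, hcomm, one_mul, mul_one]
  have hvert : ∀ v, x * (1 - Q) * F.p (G.vert v) = 0 := fun v => by
    rw [mul_assoc, hcomm']
    by_cases hv : ∀ f, G.source f = v → f ∈ T
    · have hQv : F.p (G.vert v) * Q = ∑ e ∈ T.filter (G.source · = v), F.s e * F.t e := by
        rw [hQ, Finset.mul_sum, Finset.sum_filter]
        refine Finset.sum_congr rfl fun e _ => ?_
        rw [← mul_assoc]
        split_ifs with h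
        · rw [F.p_mul_s_of_mem (A := G.vert v) h]
        · rw [F.p_mul_s_of_notMem (A := G.vert v) h, zero_mul]
      by_cases hs : G.IsSink v
      · have hQv0 : F.p (G.vert v) * Q = 0 := by
          rw [hQv, Finset.filter_false_of_mem fun e _ => hs e, Finset.sum_empty]
        rw [mul_sub, hQv0, mul_one, sub_zero]
        refine hI.mul_vert_eq_zero hL hx ?_
        have := I.mul_mem_right _ (F.p (G.vert v)) hmem
        rwa [mul_assoc, hcomm', mul_sub, hQv0, mul_one, sub_zero] at this
      · have hfin : {e : E | G.source e = v}.Finite := T.finite_toSet.subset fun e he => hv e he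
        have hne : {e : E | G.source e = v}.Nonempty := by
          simpa [IsSink, Set.Nonempty] using hs
        have : F.p (G.vert v) * Q = F.p (G.vert v) := by
          rw [hQv, F.p_vertex v hfin hne]
          refine Finset.sum_congr (Finset.ext fun e => ?_) fun _ _ => rfl
          simpa using hv e
        rw [mul_sub, this, mul_one, sub_self, mul_zero]
    · push Not at hv
      obtain ⟨f, rfl, hf⟩ := hv
      rw [← mul_assoc, hI.mul_source_eq_zero hL hx (hT f hf), zero_mul]
  -- To pass from vanishing at vertices to vanishing, the ghost edges in `Q` must disappear. Since
  -- `Q P = Q` and `x (1 - Q) P = 0`, `x Q` equals `x P`, and `x - x P` has filtration level `0`.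
  set P := ∑ v ∈ T.image G.source, F.p (G.vert v) with hP
  have hQP : Q * P = Q := by
    rw [hQ, Finset.sum_mul]
    refine Finset.sum_congr rfl fun e he => ?_
    rw [hP, Finset.mul_sum, Finset.sum_eq_single_of_mem (G.source e)
      (Finset.mem_image_of_mem _ he), mul_assoc, F.t_mul_source]
    intro v _ hv
    rw [mul_assoc, F.t_mul_p_of_notMem (A := G.vert v) hv.symm, mul_zero]
  have hxP : x * (1 - Q) * P = 0 := by
    rw [hP, Finset.mul_sum]
    exact Finset.sum_eq_zero fun v _ => hvert v
  have hx' : x * (1 - Q) = x - x * P := by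
    have h₁ : x * (1 - Q) * P = x * P - x * Q := by rw [mul_assoc, sub_mul, hQP, one_mul, mul_sub]
    rw [hxP, eq_comm, sub_eq_zero] at h₁
    rw [mul_sub, mul_one, h₁]
  rw [hx'] at hvert ⊢
  refine hI.eq_zero_of_forall_mul_vert hL (sub_mem hx ?_) hvert
  rw [hP, Finset.mul_sum]
  exact Submodule.sum_mem _ fun v _ => mul_p_mem_filtration hx _

/-- Once all `x s_f` vanish, the ghost part of `x` is determined by its ghost-free part `y`, and the
problem reduces to level `0`. -/
theorem Faithful.eq_zero_of_mem (hI : F.Faithful R I) (hL : G.ConditionL) (n : ℕ) :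
    ∀ x ∈ F.filtration R n, x ∈ I → x = 0 := by
  induction n with
  | zero =>
    intro x hx hxI
    simpa using hI.mul_one_sub_eq_zero hL hx ∅ (by simpa) fun f _ => I.mul_mem_right _ _ hxI
  | succ n ih =>
    intro x hx hxI
    have hxs : ∀ f, x * F.s f = 0 := fun f =>
      ih _ (mul_s_mem_filtration hx f) (I.mul_mem_right _ _ hxI)
    obtain ⟨y, hy, b, rfl⟩ := exists_eq_add_sum_of_mem_filtration hx
    -- The equation `x s_f = 0` reads `y s_f + b_f p_{r(f)} = 0`; multiply it by `s_f^*` on the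
    -- right.
    have key : ∀ f ∈ b.support, b f * F.t f = -(y * (F.s f * F.t f)) := fun f hf => by
      have := hxs f
      rw [add_mul, Finset.sum_mul, Finset.sum_eq_single_of_mem f hf fun e _ he => by
        rw [mul_assoc, F.t_mul_s_of_ne he, mul_zero], mul_assoc, F.t_mul_s_same] at this
      rw [← F.range_mul_t f, ← mul_assoc, ← mul_assoc, ← mul_assoc (y * F.s f),
        eq_neg_of_add_eq_zero_right this, mul_assoc y, F.s_mul_range, neg_mul]
    have heq : y + ∑ e ∈ b.support, b e * F.t e =
        y * (1 - ∑ e ∈ b.support, F.s e * F.t e) := by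
      rw [Finset.sum_congr rfl key, Finset.sum_neg_distrib, mul_sub, mul_one, Finset.mul_sum,
        sub_eq_add_neg]
    rw [heq] at hxI ⊢
    refine hI.mul_one_sub_eq_zero hL hy b.support hxI fun f hf => ?_
    have := hxs f
    rw [add_mul, Finset.sum_mul, Finset.sum_eq_zero fun e he => by
      rw [mul_assoc, F.t_mul_s_of_ne (fun h : e = f => hf (h ▸ he)), mul_zero], add_zero] at this
    rw [this]
    exact I.zero_mem

end Uniqueness

end Family

/-! ### Passage to the unitization -/

namespace LeavittPathAlgebra

variable (R : Type w) [CommRing R] {V : Type u} {E : Type v} (G : Ultragraph V E)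

variable {R G} in
theorem mk_eq_of_rel {a b : G.FreeAlg R} (h : G.Rel R a b) : mk R G a = mk R G b :=
  Quotient.sound (s := (G.leavittCon R).toSetoid) (RingConGen.Rel.of _ _
    ⟨1, a, b, h, (one_smul _ _).symm, (one_smul _ _).symm⟩)

theorem mk_sum {ι : Type*} (T : Finset ι) (f : ι → G.FreeAlg R) :
    mk R G (∑ i ∈ T, f i) = ∑ i ∈ T, mk R G (f i) :=
  map_sum (⟨⟨mk R G, mk_zero R G⟩, mk_add R G⟩ : G.FreeAlg R →+ G.LeavittPathAlgebra R) f T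

/-- The generators of the Leavitt path algebra, viewed in its unitization. -/
noncomputable def unitizationFamily : Family G (Unitization R (G.LeavittPathAlgebra R)) where
  p A := (p R G A : G.LeavittPathAlgebra R)
  s e := (s R G e : G.LeavittPathAlgebra R)
  t e := (sStar R G e : G.LeavittPathAlgebra R)
  p_empty := by
    rw [← Unitization.inr_zero]
    exact congrArg _ (mk_eq_of_rel .p_empty)
  p_mul A B := by
    rw [← Unitization.inr_mul]
    exact congrArg _ (mk_eq_of_rel (.p_mul A.2 B.2))
  p_union A B := by
    rw [← Unitization.inr_add, ← Unitization.inr_sub]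
    exact congrArg _ (mk_eq_of_rel (.p_union A.2 B.2))
  source_mul_s e := by
    rw [← Unitization.inr_mul]
    exact congrArg _ (mk_eq_of_rel (.source_mul_s e))
  s_mul_range e := by
    rw [← Unitization.inr_mul]
    exact congrArg _ (mk_eq_of_rel (.s_mul_range e))
  range_mul_t e := by
    rw [← Unitization.inr_mul]
    exact congrArg _ (mk_eq_of_rel (.range_mul_t e))
  t_mul_source e := by
    rw [← Unitization.inr_mul]
    exact congrArg _ (mk_eq_of_rel (.t_mul_source e))
  t_mul_s_same e := by
    rw [← Unitization.inr_mul]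
    exact congrArg _ (mk_eq_of_rel (.t_mul_s_same e))
  t_mul_s_of_ne h := by
    rw [← Unitization.inr_mul, ← Unitization.inr_zero]
    exact congrArg _ (mk_eq_of_rel (.t_mul_s_of_ne h))
  p_vertex v hfin hne := by
    have h := mk_eq_of_rel (Rel.p_vertex (R := R) (G := G) v hfin hne)
    rw [mk_sum] at h
    simp only [← Unitization.inr_mul]
    exact (congrArg _ h).trans
      (map_sum (Unitization.inrNonUnitalAlgHom R (G.LeavittPathAlgebra R)) _ _)

variable {R G}

/-- An additive predicate holds on the Leavitt path algebra if it holds for the multiples of the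
words in the generators. -/
theorem induction_words {C : G.LeavittPathAlgebra R → Prop} (zero : C 0)
    (add : ∀ x y, C x → C y → C (x + y)) (smul : ∀ (c : R) x, C x → C (c • x))
    (word : ∀ m : FreeSemigroup G.Generator, C (mk R G (MonoidAlgebra.single m 1)))
    (x : G.LeavittPathAlgebra R) : C x := by
  obtain ⟨x, rfl⟩ := mk_surjective x
  induction x using MonoidAlgebra.induction_linear with
  | zero => exact zero
  | add x y hx hy => exact add _ _ hx hy
  | single m c =>
    have := smul c _ (word m)
    rw [← mk_smul, MonoidAlgebra.smul_single, smul_eq_mul, mul_one] at this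
    exact this

theorem mk_single_of_mul (g : G.Generator) (m : FreeSemigroup G.Generator) :
    mk R G (MonoidAlgebra.single (FreeSemigroup.of g * m) 1) =
      mk R G (G.gen R g) * mk R G (MonoidAlgebra.single m 1) := by
  rw [← mk_mul, gen, MonoidAlgebra.single_mul_single, one_mul]

/-- Right multiplication by any generator keeps an element inside the union of the filtration, so
words are built from left to right. A leading `s_e` or `s_e^*` is first written as a projection
times itself. -/
theorem exists_mem_filtration (x : G.LeavittPathAlgebra R) :
    ∃ n, (x : Unitization R (G.LeavittPathAlgebra R)) ∈
      (unitizationFamily R G).filtration R n := by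
  set F := unitizationFamily R G
  have hmul : ∀ (g : G.Generator) (n : ℕ), ∀ y ∈ F.filtration R n, ∃ k,
      y * ((mk R G (G.gen R g) : G.LeavittPathAlgebra R) : Unitization R _) ∈
        F.filtration R k := by
    intro g n y hy
    cases g with
    | proj A => exact ⟨n, Family.mul_p_mem_filtration hy A⟩
    | edge e =>
      exact ⟨n, Family.mul_s_mem_filtration (Family.filtration_le_succ n hy) e⟩
    | ghost e => exact ⟨n + 1, Family.mul_t_mem_filtration hy e⟩
  have hp : ∀ A, F.p A ∈ F.filtration R 0 := fun A => by
    simpa using Family.sl_mul_mem_filtration [] (F.p_mem_diag (R := R) A)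
  have hgen : ∀ g : G.Generator, ∃ k,
      ((mk R G (G.gen R g) : G.LeavittPathAlgebra R) : Unitization R _) ∈ F.filtration R k := by
    intro g
    cases g with
    | proj A => exact ⟨0, hp A⟩
    | edge e =>
      obtain ⟨k, hk⟩ := hmul (.edge e) 0 _ (hp (G.vert (G.source e)))
      change F.p _ * F.s e ∈ _ at hk
      rw [F.source_mul_s] at hk
      exact ⟨k, hk⟩
    | ghost e =>
      obtain ⟨k, hk⟩ := hmul (.ghost e) 0 _ (hp (G.rng e))
      change F.p _ * F.t e ∈ _ at hk
      rw [F.range_mul_t] at hk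
      exact ⟨k, hk⟩
  have hword : ∀ (m : FreeSemigroup G.Generator) (n : ℕ), ∀ y ∈ F.filtration R n, ∃ k,
      y * ((mk R G (MonoidAlgebra.single m 1) : G.LeavittPathAlgebra R) : Unitization R _) ∈
        F.filtration R k := by
    intro m
    induction m using FreeSemigroup.recOnMul with
    | ih1 g => exact hmul g
    | ih2 g m _ ih =>
      intro n y hy
      obtain ⟨k, hk⟩ := hmul g n y hy
      rw [mk_single_of_mul, Unitization.inr_mul, ← mul_assoc]
      exact ih k _ hk
  induction x using induction_words with
  | zero => exact ⟨0, by rw [Unitization.inr_zero]; exact zero_mem _⟩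
  | add x y hx hy =>
    obtain ⟨k, hk⟩ := hx
    obtain ⟨l, hl⟩ := hy
    refine ⟨max k l, ?_⟩
    rw [Unitization.inr_add]
    exact add_mem (Family.filtration_mono (le_max_left k l) hk)
      (Family.filtration_mono (le_max_right k l) hl)
  | smul c x hx =>
    obtain ⟨k, hk⟩ := hx
    exact ⟨k, by rw [Unitization.inr_smul]; exact Submodule.smul_mem _ _ hk⟩
  | word m =>
    induction m using FreeSemigroup.recOnMul with
    | ih1 g => exact hgen g
    | ih2 g m _ _ =>
      obtain ⟨k, hk⟩ := hgen g
      rw [mk_single_of_mul, Unitization.inr_mul]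
      exact hword m k _ hk

theorem exists_p_mul_eq (x : G.LeavittPathAlgebra R) : ∃ A, p R G A * x = x := by
  have hgen : ∀ g : G.Generator, ∃ A, p R G A * mk R G (G.gen R g) = mk R G (G.gen R g) := by
    intro g
    cases g with
    | proj A => exact ⟨A, Unitization.inr_injective (R := R) (by
      rw [Unitization.inr_mul]
      exact (unitizationFamily R G).p_mul_self A)⟩
    | edge e => exact ⟨G.vert (G.source e), mk_eq_of_rel (.source_mul_s e)⟩
    | ghost e => exact ⟨G.rng e, mk_eq_of_rel (.range_mul_t e)⟩
  induction x using induction_words with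
  | zero => exact ⟨⟨∅, .empty⟩, mul_zero _⟩
  | add x y hx hy =>
    obtain ⟨A, hA⟩ := hx
    obtain ⟨B, hB⟩ := hy
    have hsub : ∀ {A B : G.GenVertex}, A.1 ⊆ B.1 → p R G B * p R G A = p R G A := fun h =>
      Unitization.inr_injective (R := R) (by
        rw [Unitization.inr_mul]
        exact ((unitizationFamily R G).p_comm _ _).trans
          ((unitizationFamily R G).p_mul_of_subset h))
    refine ⟨⟨A.1 ∪ B.1, .union A.2 B.2⟩, ?_⟩
    rw [mul_add]
    nth_rewrite 1 [← hA]
    nth_rewrite 1 [← hB]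
    rw [← mul_assoc, ← mul_assoc, hsub Set.subset_union_left, hsub Set.subset_union_right, hA, hB]
  | smul c x hx =>
    obtain ⟨A, hA⟩ := hx
    exact ⟨A, by rw [mul_smul_comm, hA]⟩
  | word m =>
    induction m using FreeSemigroup.recOnMul with
    | ih1 g => exact hgen g
    | ih2 g m _ _ =>
      obtain ⟨A, hA⟩ := hgen g
      exact ⟨A, by rw [mk_single_of_mul, ← mul_assoc, hA]⟩

/-- As `π` is only a ring homomorphism, scalars are moved onto a local unit: `c x = (c p_A) x`. This
makes the kernel an ideal of the unitization. -/
theorem map_smul_eq_zero {S : Type x} [NonUnitalRing S] (π : G.LeavittPathAlgebra R →ₙ+* S) (c : R)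
    {x : G.LeavittPathAlgebra R} (hx : π x = 0) : π (c • x) = 0 := by
  obtain ⟨A, hA⟩ := exists_p_mul_eq x
  rw [← hA, ← smul_mul_assoc, map_mul, hx, mul_zero]

/-- The kernel of a ring homomorphism on the Leavitt path algebra, as an ideal of the
unitization. -/
noncomputable def kerUnitization {S : Type x} [NonUnitalRing S] (π : G.LeavittPathAlgebra R →ₙ+* S) :
    TwoSidedIdeal (Unitization R (G.LeavittPathAlgebra R)) :=
  .mk' {u | u.fst = 0 ∧ π u.snd = 0}
    ⟨rfl, map_zero π⟩
    (fun {u v} hu hv => ⟨by simp [hu.1, hv.1], by simp [hu.2, hv.2]⟩)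
    (fun {u} hu => ⟨by simp [hu.1], by simp [hu.2]⟩)
    (fun {u v} hv => ⟨by simp [hv.1], by simp [hv.1, hv.2, map_smul_eq_zero π _ hv.2]⟩)
    (fun {u v} hu => ⟨by simp [hu.1], by simp [hu.1, hu.2, map_smul_eq_zero π _ hu.2]⟩)

theorem mem_kerUnitization {S : Type x} [NonUnitalRing S] {π : G.LeavittPathAlgebra R →ₙ+* S}
    {y : G.LeavittPathAlgebra R} :
    (y : Unitization R (G.LeavittPathAlgebra R)) ∈ kerUnitization π ↔ π y = 0 := by
  rw [kerUnitization, TwoSidedIdeal.mem_mk']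
  simp

end LeavittPathAlgebra

end Ultragraph

theorem mainTheorem5 {V E R S : Type*} [CommRing R] [NonUnitalRing S]
    (G : Ultragraph V E) (hL : G.ConditionL)
    (π : G.LeavittPathAlgebra R →ₙ+* S)
    (hπ : ∀ A : G.GenVertex, A.1.Nonempty → ∀ r : R, r ≠ 0 →
      π (r • Ultragraph.LeavittPathAlgebra.p R G A) ≠ 0) :
    Function.Injective π := by
  refine (injective_iff_map_eq_zero π).2 fun x hx => ?_
  have hI : (Ultragraph.LeavittPathAlgebra.unitizationFamily R G).Faithful R
      (Ultragraph.LeavittPathAlgebra.kerUnitization π) := fun v r hr => by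
    by_contra h
    refine hπ (G.vert v) (Set.singleton_nonempty v) r h ?_
    rw [← Ultragraph.LeavittPathAlgebra.mem_kerUnitization, Unitization.inr_smul]
    exact hr
  obtain ⟨n, hn⟩ := Ultragraph.LeavittPathAlgebra.exists_mem_filtration x
  exact Unitization.inr_injective
    (hI.eq_zero_of_mem hL n _ hn (Ultragraph.LeavittPathAlgebra.mem_kerUnitization.2 hx))
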